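/- For a finite simple graph $G$ with adjacency matrix $A(G)$ and diagonal degree matrix $D(G)$ and for $\alpha\in[0,1]$, let $A_\alpha(G)=A(G)+\alpha\,(D(G)-A(G))$ and let $\rho_\alpha(G)$ be the largest eigenvalue of $A_\alpha(G)$. A real number $\lambda$ is an *$A_\alpha$-limit point* if there is a sequence of graphs $(G_k)$ whose numbers $\rho_\alpha(G_k)$ are pairwise distinct and converge to $\lambda$. For $\lambda>2$ and $0\le\alpha<1$ put $$\delta_\alpha=\alpha+\frac{(1-\alpha)^2}{\lambda-\alpha},\qquad \theta'_\alpha=\frac{(2\alpha-\lambda)+\sqrt{(2\alpha-\lambda)^2-4(1-\alpha)^2}}{2},$$ $$F_0(\lambda,\alpha)=3\alpha-\lambda-\frac{(1-\alpha)^2}{\alpha-\lambda}-2\theta'_\alpha,\qquad F_1(\lambda,\alpha)=(2\alpha-\lambda+\delta_\alpha)(\theta'_\alpha-\delta_\alpha)-2(1-\alpha)^2,$$ and let $\tau_0(\alpha)$ denote the unique solution $\lambda>2$ of $F_0(\lambda,\alpha)=0$. Let $\alpha^*=\frac{3-\sqrt2}{7}$. **Theorem.** 1. Let $0<\alpha<\alpha^*$.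 Then $\tau_0(\alpha)$ exists, the equation $(2\alpha-\lambda+\delta_\alpha)(\theta'_\alpha-\delta_\alpha)=2(1-\alpha)^2$ has exactly two solutions $\tau_1(\alpha)<\tau_1'(\alpha)$ in $(2,\infty)$, $\tau_1(\alpha)=\tau_0(\alpha)$, $F_1(\lambda,\alpha)<0$ for $\tau_1(\alpha)<\lambda<\tau_1'(\alpha)$, and every $\lambda\in[\tau_1(\alpha),\tau_1'(\alpha))$ is an $A_\alpha$-limit point. 2. Let $\alpha=0$. Then $\tau_0(0)=\sqrt{2+\sqrt5}$, this is the only zero of $F_1(\cdot,0)$ in $(2,\infty)$, $F_1(\lambda,0)<0$ for all $\lambda>\sqrt{2+\sqrt5}$, and every $\lambda\in[\sqrt{2+\sqrt5},\infty)$ is an $A_0$-limit point (so here $\tau_1(0)=\sqrt{2+\sqrt5}$ and $\tau_1'(0)=\infty$). 3. For $\alpha=\alpha^*$ the two solutions coincide: $\tau_0(\alpha^*)$ exists and is the only zero of $F_1(\cdot,\alpha^*)$ in $(2,\infty)$. 4. $\alpha^*$ is the largest $\beta\in(0,1]$ such that for every $0<\alpha<\beta$ the zeros of $F_1(\cdot,\alpha)$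 in $(2,\infty)$ are exactly two numbers $\tau_1(\alpha)<\tau_1'(\alpha)$ with $\tau_1(\alpha)=\tau_0(\alpha)$, and $F_1(\lambda,\alpha)<0$ for $\tau_1(\alpha)<\lambda<\tau_1'(\alpha)$. -/

import Mathlib

noncomputable section

/-! ### The matrix `A_α(G)`, its largest eigenvalue, and `A_α`-limit points -/

open Classical in
/-- `A_α(G) = A(G) + α (D(G) - A(G))` for a finite simple graph `G`, where `A(G)` is the adjacency
matrix and `D(G)` the diagonal matrix of vertex degrees. -/
def alphaMatrix {V : Type*} [Fintype V] (α : ℝ) (G : SimpleGraph V) : Matrix V V ℝ :=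
  G.adjMatrix ℝ + α • (G.degMatrix ℝ - G.adjMatrix ℝ)

open Classical in
/-- The largest eigenvalue of `A_α(G)`. For a nonempty vertex set the spectrum is a finite
nonempty set of reals (the matrix is symmetric), so the supremum is a maximum. -/
def alphaRadius {V : Type*} [Fintype V] (α : ℝ) (G : SimpleGraph V) : ℝ :=
  sSup (spectrum ℝ (alphaMatrix α G))

/-- `l` is an `A_α`-limit point: there is a sequence of finite nonempty graphs whose
`A_α`-spectral radii are pairwise distinct and converge to `l`. -/
def IsAlphaLimitPoint (α l : ℝ) : Prop :=
  ∃ (n : ℕ → ℕ) (G : ∀ k, SimpleGraph (Fin (n k + 1))),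
    Function.Injective (fun k => alphaRadius α (G k)) ∧
      Filter.Tendsto (fun k => alphaRadius α (G k)) Filter.atTop (nhds l)

/-! ### The equations that define `τ₀`, `τ₁`, `τ₁'`

All of them are considered for `l > 2` and `0 ≤ α < 1` only; there
`(2α - l)² > 4(1 - α)²` and `l > α`. -/

/-- `δ_α = α + (1 - α)² / (l - α)`. -/
def deltaAlpha (α l : ℝ) : ℝ := α + (1 - α) ^ 2 / (l - α)

/-- `θ'_α = ((2α - l) + √((2α - l)² - 4(1 - α)²)) / 2`. -/
def thetaAlpha' (α l : ℝ) : ℝ :=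
  ((2 * α - l) + √((2 * α - l) ^ 2 - 4 * (1 - α) ^ 2)) / 2

/-- `F₀(l, α) = 3α - l - (1 - α)² / (α - l) - 2 θ'_α`. -/
def funF0 (α l : ℝ) : ℝ := 3 * α - l - (1 - α) ^ 2 / (α - l) - 2 * thetaAlpha' α l

/-- `F₁(l, α) = (2α - l + δ_α)(θ'_α - δ_α) - 2(1 - α)²`. -/
def funF1 (α l : ℝ) : ℝ :=
  (2 * α - l + deltaAlpha α l) * (thetaAlpha' α l - deltaAlpha α l) - 2 * (1 - α) ^ 2

/-- `t = τ₀(α)`: the only solution `l > 2` of `F₀(l, α) = 0` is `t`. -/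
def IsTau0 (α t : ℝ) : Prop := {l : ℝ | 2 < l ∧ funF0 α l = 0} = {t}

/-- `t = τ₁(α)` and `t' = τ₁'(α)`: `t < t'` are exactly the solutions `l > 2` of
`(2α - l + δ_α)(θ'_α - δ_α) = 2(1 - α)²`, and the smaller one is `τ₀(α)`. -/
def IsTau1Pair (α t t' : ℝ) : Prop :=
  IsTau0 α t ∧ t < t' ∧ {l : ℝ | 2 < l ∧ funF1 α l = 0} = {t, t'}

/-- `α* = (3 - √2) / 7`. -/
def alphaStar : ℝ := (3 - √2) / 7

end

/-!
Write `l = 2α + (1 - α)(s + s⁻¹)` with `0 < s < 1` and `γ = α / (1 - α)`. Along the spine of a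
caterpillar the eigenvalue equation for `l` becomes a first-order recursion for the ratios `c n` of
consecutive entries, in which every leaf lowers the ratio by a fixed amount `D`. Leaves are attached
greedily, as many as keep the ratio at least `s`, which is possible for ever. The resulting positive
vector fails the eigenvalue equation only at the last spine vertex, where the defect has the sign
that forces the spectral radius to be less than `l`, and Rayleigh's quotient differs from `l` by at
most a constant times the relative weight of the last spine vertex.

If `F₀ < 0`, a ratio greater than `1` would without further leaves grow beyond `s + D`, so a leaf
follows. If moreover `F₁ ≤ 0`, this leaf makes the ratios after it at most the inverses of the
mirror-image ratios before it. So the spine entries return again and again below earlier values,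
their relative weight tends to `0` along a subsequence, and `l` is a limit of smaller spectral
radii.

In terms of `s`, the sign of `F₀` is that of a quartic `Q`, and the sign of `F₁` is that of `Q`
times a function `g`; both increase with `s`, and `Q` increases with `γ` while `g` decreases. The
roots of `Q` and `g` meet at `s = 1 / √2`, `γ = 1 - 1 / √2`, that is, at `α = α*`.
-/

open Filter Finset Matrix Topology

section SymmetricMatrices

variable {V : Type*}

theorem apply_eq_of_preconnected {G : SimpleGraph V} (hG : G.Preconnected) {β : Type*} {f : V → β}
    (hf : ∀ u v, G.Adj u v → f u = f v) (u v : V) : f u = f v := by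
  obtain ⟨p⟩ := hG u v
  induction p with
  | nil => rfl
  | cons h _ ih => exact (hf _ _ h).trans ih

variable [Fintype V] {A : Matrix V V ℝ}

/-- Ground-state representation: for `A x = l x` the left side is the form of `l - A` at `z x`. -/
theorem dotProduct_mulVec_sub_dotProduct_mulVec_mul (hA : A.IsSymm) (x z : V → ℝ) :
    (z * z * x) ⬝ᵥ A *ᵥ x - (z * x) ⬝ᵥ A *ᵥ (z * x)
      = 2⁻¹ * ∑ u, ∑ v, A u v * x u * x v * (z u - z v) ^ 2 := by
  have hswap : ∑ u, ∑ v, A u v * x u * x v * z u ^ 2 = ∑ u, ∑ v, A u v * x u * x v * z v ^ 2 := by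
    rw [sum_comm]
    refine sum_congr rfl fun u _ => sum_congr rfl fun v _ => ?_
    rw [hA.apply]
    ring
  have hsquare : ∀ u v, A u v * x u * x v * (z u - z v) ^ 2
      = A u v * x u * x v * z u ^ 2 + A u v * x u * x v * z v ^ 2
        - 2 * (A u v * x u * x v * (z u * z v)) := fun u v => by ring
  have hfirst : (z * z * x) ⬝ᵥ A *ᵥ x = ∑ u, ∑ v, A u v * x u * x v * z u ^ 2 := by
    simp only [mulVec, dotProduct, mul_sum, Pi.mul_apply]
    exact sum_congr rfl fun u _ => sum_congr rfl fun v _ => by ring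
  have hsecond : (z * x) ⬝ᵥ A *ᵥ (z * x) = ∑ u, ∑ v, A u v * x u * x v * (z u * z v) := by
    simp only [mulVec, dotProduct, mul_sum, Pi.mul_apply]
    exact sum_congr rfl fun u _ => sum_congr rfl fun v _ => by ring
  simp only [hsquare, sum_sub_distrib, sum_add_distrib, ← mul_sum]
  rw [hfirst, hsecond, ← hswap]
  ring

theorem defect_add_dirichlet_eq_of_mulVec_eq_smul (hA : A.IsSymm) {x z : V → ℝ} {l μ : ℝ}
    (h : A *ᵥ (z * x) = μ • (z * x)) :
    ∑ v, z v ^ 2 * x v * (l * x v - (A *ᵥ x) v)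
      + 2⁻¹ * ∑ u, ∑ v, A u v * x u * x v * (z u - z v) ^ 2
      = (l - μ) * ((z * x) ⬝ᵥ (z * x)) := by
  rw [← dotProduct_mulVec_sub_dotProduct_mulVec_mul hA, h]
  simp only [dotProduct, Pi.mul_apply, Pi.smul_apply, smul_eq_mul, mul_sum, ← sum_add_distrib,
    ← sum_sub_distrib]
  exact sum_congr rfl fun v _ => by ring

variable [DecidableEq V]

theorem dotProduct_mulVec_le_sSup_spectrum (hA : A.IsHermitian) (x : V → ℝ) :
    x ⬝ᵥ A *ᵥ x ≤ sSup (spectrum ℝ A) * (x ⬝ᵥ x) := by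
  have hpsd : (algebraMap ℝ (Matrix V V ℝ) (sSup (spectrum ℝ A)) - A).PosSemidef := by
    rw [posSemidef_iff_isHermitian_and_spectrum_nonneg, ← spectrum.singleton_sub_eq]
    refine ⟨?_, ?_⟩
    · rw [Matrix.algebraMap_eq_diagonal]
      exact (isHermitian_diagonal _).sub hA
    · rintro _ ⟨_, rfl, μ, hμ, rfl⟩
      exact sub_nonneg.2 (le_csSup A.finite_real_spectrum.bddAbove hμ)
  have hnonneg := hpsd.dotProduct_mulVec_nonneg x
  rw [sub_mulVec, dotProduct_sub, Algebra.algebraMap_eq_smul_one, smul_mulVec, one_mulVec,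
    dotProduct_smul, star_trivial, smul_eq_mul] at hnonneg
  exact sub_nonneg.1 hnonneg

theorem exists_mulVec_eq_sSup_spectrum_smul [Nonempty V] (hA : A.IsHermitian) :
    ∃ y : V → ℝ, y ≠ 0 ∧ A *ᵥ y = sSup (spectrum ℝ A) • y := by
  obtain ⟨i, hi⟩ := exists_eq_ciSup_of_finite (f := hA.eigenvalues)
  refine ⟨hA.eigenvectorBasis i, fun h => hA.eigenvectorBasis.orthonormal.ne_zero i ?_, ?_⟩
  · exact (WithLp.ofLp_eq_zero 2).1 h
  · rw [hA.mulVec_eigenvectorBasis, hi, hA.spectrum_real_eq_range_eigenvalues, iSup]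

theorem sub_div_le_sSup_spectrum_of_mulVec_eq (hA : A.IsHermitian) {x : V → ℝ} {l d : ℝ} {w : V}
    (hx : x ≠ 0) (h : A *ᵥ x = l • x - Pi.single w d) :
    l - d * x w / (x ⬝ᵥ x) ≤ sSup (spectrum ℝ A) := by
  have hxx : 0 < x ⬝ᵥ x := by simpa using dotProduct_star_self_pos_iff.2 hx
  have hrayleigh := dotProduct_mulVec_le_sSup_spectrum hA x
  rw [h, dotProduct_sub, dotProduct_smul, dotProduct_single, smul_eq_mul] at hrayleigh
  rw [← mul_le_mul_iff_left₀ hxx, sub_mul, div_mul_cancel₀ _ hxx.ne']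
  linarith

theorem sSup_spectrum_lt_of_mulVec_lt (hA : A.IsHermitian) (hoff : ∀ u v, u ≠ v → 0 ≤ A u v)
    {G : SimpleGraph V} (hG : G.Connected) (hadj : ∀ u v, G.Adj u v → 0 < A u v)
    {x : V → ℝ} (hx : ∀ v, 0 < x v) {l : ℝ} (hlt : A *ᵥ x < l • x) :
    sSup (spectrum ℝ A) < l := by
  have := hG.nonempty
  obtain ⟨hle, w, hw⟩ := Pi.lt_def.1 hlt
  have hpos : 0 < l * x w - (A *ᵥ x) w := sub_pos.2 hw
  obtain ⟨y, hy0, hy⟩ := exists_mulVec_eq_sSup_spectrum_smul hA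
  obtain ⟨z, rfl⟩ : ∃ z, y = z * x := ⟨y / x, funext fun v => by simp [(hx v).ne']⟩
  by_contra! hge
  have hdefect : ∀ v ∈ univ, 0 ≤ z v ^ 2 * x v * (l * x v - (A *ᵥ x) v) := fun v _ =>
    mul_nonneg (mul_nonneg (sq_nonneg _) (hx v).le) (sub_nonneg.2 (hle v))
  have hedge : ∀ u v, 0 ≤ A u v * x u * x v * (z u - z v) ^ 2 := by
    intro u v
    rcases eq_or_ne u v with rfl | huv
    · simp
    · exact mul_nonneg (mul_nonneg (mul_nonneg (hoff u v huv) (hx u).le) (hx v).le) (sq_nonneg _)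
  have hedge_sum : ∀ u ∈ univ, 0 ≤ ∑ v, A u v * x u * x v * (z u - z v) ^ 2 := fun u _ =>
    sum_nonneg fun v _ => hedge u v
  have hidentity := defect_add_dirichlet_eq_of_mulVec_eq_smul (l := l)
    (isHermitian_iff_isSymm.1 hA) hy
  have hform : (l - sSup (spectrum ℝ A)) * ((z * x) ⬝ᵥ (z * x)) ≤ 0 :=
    mul_nonpos_of_nonpos_of_nonneg (sub_nonpos.2 hge) (sum_nonneg fun v _ => mul_self_nonneg _)
  have hdefect_nonneg := sum_nonneg hdefect
  have hedge_nonneg := sum_nonneg hedge_sum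
  have hconst : ∀ u v, G.Adj u v → z u = z v := fun u v huv => by
    have hzero := (sum_eq_zero_iff_of_nonneg hedge_sum).1 (by linarith) u (mem_univ u)
    have hzero := (sum_eq_zero_iff_of_nonneg fun v _ => hedge u v).1 hzero v (mem_univ v)
    simpa [(hadj u v huv).ne', (hx u).ne', (hx v).ne', sub_eq_zero] using hzero
  have hzw : z w = 0 := by
    have hzero := (sum_eq_zero_iff_of_nonneg hdefect).1 (by linarith) w (mem_univ w)
    simpa [(hx w).ne', hpos.ne'] using hzero
  exact hy0 (funext fun v => by
    simp [apply_eq_of_preconnected hG.preconnected hconst v w, hzw])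

end SymmetricMatrices

section AlphaMatrix

variable {V : Type*} [Fintype V] {α : ℝ} {G : SimpleGraph V}

theorem alphaMatrix_apply [DecidableEq V] [DecidableRel G.Adj] (α : ℝ) (u v : V) :
    alphaMatrix α G u v
      = (if u = v then α * G.degree u else 0) + if G.Adj u v then 1 - α else 0 := by
  have hdef : alphaMatrix α G
      = G.adjMatrix ℝ + α • (G.degMatrix ℝ - G.adjMatrix ℝ) := by
    unfold alphaMatrix
    congr!
  simp only [hdef, SimpleGraph.degMatrix, Matrix.add_apply, Matrix.smul_apply,
    Matrix.sub_apply, SimpleGraph.adjMatrix_apply, Matrix.diagonal_apply, smul_eq_mul]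
  split_ifs <;> ring

theorem alphaMatrix_mulVec_apply [DecidableRel G.Adj] (α : ℝ) (x : V → ℝ) (u : V) :
    (alphaMatrix α G *ᵥ x) u = ∑ v, if G.Adj u v then α * x u + (1 - α) * x v else 0 := by
  classical
  simp only [mulVec, dotProduct, alphaMatrix_apply, add_mul, ite_mul, zero_mul, sum_add_distrib,
    Finset.sum_ite_eq, mem_univ, if_true, ← sum_filter, sum_const, ← mul_sum,
    ← SimpleGraph.neighborFinset_eq_filter, SimpleGraph.card_neighborFinset_eq_degree,
    nsmul_eq_mul]
  ring

theorem alphaMatrix_isHermitian (α : ℝ) (G : SimpleGraph V) : (alphaMatrix α G).IsHermitian := by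
  classical
  exact IsHermitian.ext fun u v => by
    simp only [alphaMatrix_apply, star_trivial, G.adj_comm u v]
    grind

theorem alphaRadius_congr {W : Type*} [Fintype W] {H : SimpleGraph W} (e : G ≃g H) (α : ℝ) :
    alphaRadius α G = alphaRadius α H := by
  classical
  have hmatrix : alphaMatrix α G = (alphaMatrix α H).submatrix e e := by
    ext u v
    simp only [submatrix_apply, alphaMatrix_apply, e.map_adj_iff, e.injective.eq_iff, e.degree_eq]
  rw [alphaRadius, alphaRadius, ← AlgEquiv.spectrum_eq (reindexAlgEquiv ℝ ℝ e.toEquiv.symm)]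
  congr!

theorem sub_div_le_alphaRadius [DecidableEq V] {x : V → ℝ} {l d : ℝ} {w : V} (hx : x ≠ 0)
    (h : alphaMatrix α G *ᵥ x = l • x - Pi.single w d) :
    l - d * x w / (x ⬝ᵥ x) ≤ alphaRadius α G := by
  convert sub_div_le_sSup_spectrum_of_mulVec_eq (alphaMatrix_isHermitian α G) hx h
  unfold alphaRadius
  congr!

theorem alphaRadius_lt (hG : G.Connected) (hα : α < 1) {x : V → ℝ} (hx : ∀ v, 0 < x v) {l : ℝ}
    (hlt : alphaMatrix α G *ᵥ x < l • x) : alphaRadius α G < l := by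
  classical
  have hoff : ∀ u v, u ≠ v → alphaMatrix α G u v = if G.Adj u v then 1 - α else 0 :=
    fun u v huv => by rw [alphaMatrix_apply, if_neg huv, zero_add]
  convert sSup_spectrum_lt_of_mulVec_lt (alphaMatrix_isHermitian α G) (fun u v huv => ?_) hG
    (fun u v huv => ?_) hx hlt
  · unfold alphaRadius
    congr!
  · rw [hoff u v huv]
    split_ifs
    exacts [sub_nonneg.2 hα.le, le_rfl]
  · rw [hoff u v huv.ne, if_pos huv]
    exact sub_pos.2 hα

end AlphaMatrix

section LimitPoints

theorem exists_injective_tendsto_of_mem_derivedSet {X : Type*} [MetricSpace X] {S : Set X} {x : X}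
    (hx : x ∈ derivedSet S) :
    ∃ u : ℕ → X, Function.Injective u ∧ (∀ k, u k ∈ S) ∧ Tendsto u atTop (𝓝 x) := by
  have : (𝓝[≠] x ⊓ 𝓟 S).NeBot := hx
  obtain ⟨u, hu⟩ := exists_seq_tendsto (𝓝[≠] x ⊓ 𝓟 S)
  obtain ⟨hne, hS⟩ := tendsto_inf.1 hu
  have hdist : Tendsto (fun k => (dist (u k) x)⁻¹) atTop atTop := by
    refine tendsto_inv_nhdsGT_zero.comp (tendsto_nhdsWithin_iff.2
      ⟨tendsto_iff_dist_tendsto_zero.1 (tendsto_nhdsWithin_iff.1 hne).1, ?_⟩)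
    filter_upwards [(tendsto_nhdsWithin_iff.1 hne).2] with k hk
    exact dist_pos.2 hk
  obtain ⟨N, hN⟩ := eventually_atTop.1 (tendsto_principal.1 hS)
  obtain ⟨φ, hφ, hmono⟩ := strictMono_subseq_of_tendsto_atTop
    (hdist.comp (tendsto_add_atTop_nat N))
  refine ⟨fun k => u (φ k + N), fun j k hjk => hmono.injective ?_, fun k => hN _ (by simp), ?_⟩
  · simp only [Function.comp_apply]
    exact congrArg (fun y => (dist y x)⁻¹) hjk
  · exact (tendsto_nhdsWithin_iff.1 hne).1.comp
      ((tendsto_add_atTop_nat N).comp hφ.tendsto_atTop)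

/-- The set of all `A_α`-spectral radii of finite nonempty graphs. -/
def alphaRadii (α : ℝ) : Set ℝ :=
  {ρ | ∃ (n : ℕ) (G : SimpleGraph (Fin (n + 1))), alphaRadius α G = ρ}

theorem isAlphaLimitPoint_of_mem_derivedSet {α l : ℝ} (hl : l ∈ derivedSet (alphaRadii α)) :
    IsAlphaLimitPoint α l := by
  obtain ⟨u, hinj, hmem, hlim⟩ := exists_injective_tendsto_of_mem_derivedSet hl
  choose n G hG using hmem
  exact ⟨n, G, by simpa only [hG] using hinj, by simpa only [hG] using hlim⟩

theorem alphaRadius_mem_alphaRadii {V : Type*} [Fintype V] [Nonempty V] (α : ℝ)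
    (G : SimpleGraph V) : alphaRadius α G ∈ alphaRadii α :=
  have hcard : Fintype.card V = Fintype.card V - 1 + 1 :=
    (Nat.sub_add_cancel Fintype.card_pos).symm
  ⟨_, G.overFin hcard, (alphaRadius_congr (G.overFinIso hcard) α).symm⟩

end LimitPoints

section Pendants

variable {V : Type*} {G : SimpleGraph V} {r : V → ℕ}

/-- The graph obtained from `G` by attaching `r v` pendant vertices to every vertex `v`. -/
def attachPendants (G : SimpleGraph V) (r : V → ℕ) : SimpleGraph (V ⊕ Σ v, Fin (r v)) where
  Adj
    | .inl u, .inl v => G.Adj u v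
    | .inl u, .inr p => p.1 = u
    | .inr p, .inl u => p.1 = u
    | .inr _, .inr _ => False
  symm := ⟨by rintro (u | p) (v | q) h <;> first | exact h.symm | exact h⟩
  loopless := ⟨by rintro (u | p) h; exacts [G.irrefl h, h]⟩

theorem attachPendants_connected (hG : G.Connected) (r : V → ℕ) :
    (attachPendants G r).Connected := by
  let ι : G →g attachPendants G r := ⟨Sum.inl, id⟩
  have hbase : ∀ v, ∃ u, (attachPendants G r).Reachable v (ι u) := by
    rintro (u | p)
    · exact ⟨u, .refl _⟩
    · exact ⟨p.1, SimpleGraph.Adj.reachable (show p.1 = p.1 from rfl)⟩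
  have := hG.nonempty
  refine ⟨fun v w => ?_⟩
  obtain ⟨v', hv⟩ := hbase v
  obtain ⟨w', hw⟩ := hbase w
  exact (hv.trans ((hG.preconnected v' w').map ι)).trans hw.symm

/-- The extension of a vector `x` on `G` to `attachPendants G r` that satisfies the eigenvalue
equation of `A_α` for the eigenvalue `l` at every pendant vertex. -/
noncomputable def pendantExtension (α l : ℝ) (r : V → ℕ) (x : V → ℝ) : (V ⊕ Σ v, Fin (r v)) → ℝ :=
  Sum.elim x fun p => (1 - α) * x p.1 / (l - α)

theorem pendantExtension_pos {α l : ℝ} (hα : α < 1) (hl : α < l) {x : V → ℝ}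
    (hx : ∀ v, 0 < x v) (v) : 0 < pendantExtension α l r x v := by
  rcases v with v | p
  · exact hx v
  · exact div_pos (mul_pos (sub_pos.2 hα) (hx _)) (sub_pos.2 hl)

variable [Fintype V]

theorem alphaMatrix_attachPendants_mulVec_inl (α l : ℝ) (r : V → ℕ) (x : V → ℝ) (v : V) :
    (alphaMatrix α (attachPendants G r) *ᵥ pendantExtension α l r x) (.inl v)
      = (alphaMatrix α G *ᵥ x) v + r v * deltaAlpha α l * x v := by
  classical
  have hpendant : ∀ p : Σ v, Fin (r v), (attachPendants G r).Adj (.inl v) (.inr p) ↔ p.1 = v :=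
    fun _ => Iff.rfl
  have hbase : ∀ u, (attachPendants G r).Adj (.inl v) (.inl u) ↔ G.Adj v u := fun _ => Iff.rfl
  simp only [alphaMatrix_mulVec_apply, Fintype.sum_sum_type, Fintype.sum_sigma, hpendant, hbase,
    pendantExtension, Sum.elim_inl, Sum.elim_inr, sum_const, card_univ, Fintype.card_fin,
    nsmul_eq_mul, mul_ite, mul_zero, Finset.sum_ite_eq', mem_univ, if_true, deltaAlpha]
  ring

theorem alphaMatrix_attachPendants_mulVec_inr {α l : ℝ} (hl : l ≠ α) (r : V → ℕ) (x : V → ℝ)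
    (p : Σ v, Fin (r v)) :
    (alphaMatrix α (attachPendants G r) *ᵥ pendantExtension α l r x) (.inr p)
      = l * pendantExtension α l r x (.inr p) := by
  classical
  have hpendant : ∀ q, ¬(attachPendants G r).Adj (.inr p) (.inr q) := fun _ => id
  have hbase : ∀ u, (attachPendants G r).Adj (.inr p) (.inl u) ↔ p.1 = u := fun _ => Iff.rfl
  simp only [alphaMatrix_mulVec_apply, Fintype.sum_sum_type, hpendant, hbase, if_false,
    sum_const_zero, add_zero, Finset.sum_ite_eq, mem_univ, if_true, pendantExtension,
    Sum.elim_inl, Sum.elim_inr]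
  field_simp [sub_ne_zero.2 hl]
  ring

theorem alphaMatrix_attachPendants_mulVec_eq [DecidableEq V] {α l d : ℝ} {w : V} (hl : l ≠ α)
    {x : V → ℝ} (h : ∀ v, (alphaMatrix α G *ᵥ x) v + r v * deltaAlpha α l * x v
      = l * x v - (Pi.single w d : V → ℝ) v) :
    alphaMatrix α (attachPendants G r) *ᵥ pendantExtension α l r x
      = l • pendantExtension α l r x - Pi.single (.inl w) d := by
  ext (v | p)
  · rw [alphaMatrix_attachPendants_mulVec_inl, h]
    simp [pendantExtension, Pi.single_apply]
  · rw [alphaMatrix_attachPendants_mulVec_inr hl]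
    simp

end Pendants

section Caterpillars

theorem alphaMatrix_pathGraph_mulVec (α : ℝ) (x : ℕ → ℝ) {n : ℕ} (i : Fin (n + 1)) :
    (alphaMatrix α (SimpleGraph.pathGraph (n + 1)) *ᵥ fun j => x j) i
      = (if (i : ℕ) < n then α * x i + (1 - α) * x (i + 1) else 0)
        + if 0 < (i : ℕ) then α * x i + (1 - α) * x (i - 1) else 0 := by
  classical
  have hsplit : ∀ j : ℕ, (if (i : ℕ) + 1 = j ∨ j + 1 = i then α * x i + (1 - α) * x j else 0)
      = (if i + 1 = j then α * x i + (1 - α) * x (i + 1) else 0)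
        + if 0 < (i : ℕ) then if i - 1 = j then α * x i + (1 - α) * x (i - 1) else 0 else 0 := by
    intro j
    rcases eq_or_ne j (i + 1) with rfl | hj
    · grind
    · grind
  simp only [alphaMatrix_mulVec_apply, SimpleGraph.pathGraph_adj]
  rw [Fin.sum_univ_eq_sum_range
    (fun j => if (i : ℕ) + 1 = j ∨ j + 1 = i then α * x i + (1 - α) * x j else 0)]
  simp only [hsplit, sum_add_distrib, Finset.sum_ite_eq, mem_range, Nat.add_lt_add_iff_right]
  congr 1
  split_ifs with hi
  · rw [Finset.sum_ite_eq, if_pos (mem_range.2 (by omega))]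
  · simp

/-- The caterpillar with spine `0, …, n` and `r i` pendant vertices at the spine vertex `i`. -/
def caterpillar (n : ℕ) (r : ℕ → ℕ) : SimpleGraph (Fin (n + 1) ⊕ Σ i : Fin (n + 1), Fin (r i)) :=
  attachPendants (SimpleGraph.pathGraph (n + 1)) fun i => r i

/-- The vector on `caterpillar n r` with spine entries `x i`, extended to the pendant vertices. -/
noncomputable def caterpillarVector (α l : ℝ) (n : ℕ) (r : ℕ → ℕ) (x : ℕ → ℝ) :
    (Fin (n + 1) ⊕ Σ i : Fin (n + 1), Fin (r i)) → ℝ :=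
  pendantExtension α l (fun i : Fin (n + 1) => r i) fun i => x i

/-- Spine weights `x i` that satisfy the eigenvalue equation of `A_α` for the eigenvalue `l` along
the infinite caterpillar with `r i` pendant vertices at the spine vertex `i`. -/
structure IsSpineWeight (α l : ℝ) (r : ℕ → ℕ) (x : ℕ → ℝ) : Prop where
  pos : ∀ n, 0 < x n
  zero : α * x 0 + (1 - α) * x 1 + r 0 * deltaAlpha α l * x 0 = l * x 0
  succ : ∀ n, 2 * α * x (n + 1) + (1 - α) * (x n + x (n + 2))
    + r (n + 1) * deltaAlpha α l * x (n + 1) = l * x (n + 1)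

namespace IsSpineWeight

variable {α l : ℝ} {r : ℕ → ℕ} {x : ℕ → ℝ}

theorem alphaMatrix_mulVec_eq (hx : IsSpineWeight α l r x) (hl : α < l) (n : ℕ) :
    alphaMatrix α (caterpillar n r) *ᵥ caterpillarVector α l n r x
      = l • caterpillarVector α l n r x
        - Pi.single (.inl (Fin.last n)) (α * x n + (1 - α) * x (n + 1)) := by
  refine alphaMatrix_attachPendants_mulVec_eq hl.ne' fun i => ?_
  rw [alphaMatrix_pathGraph_mulVec, Pi.single_apply]
  obtain ⟨i, hi⟩ := i
  simp only [Fin.ext_iff, Fin.val_last]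
  rcases i with _ | i
  · have := hx.zero
    grind
  · have := hx.succ i
    grind

theorem alphaRadius_caterpillar_lt (hx : IsSpineWeight α l r x) (h0 : 0 ≤ α) (h1 : α < 1)
    (hl : α < l) (n : ℕ) : alphaRadius α (caterpillar n r) < l := by
  have hconn : (caterpillar n r).Connected :=
    attachPendants_connected (SimpleGraph.pathGraph_connected n) _
  have hdefect : 0 < α * x n + (1 - α) * x (n + 1) :=
    add_pos_of_nonneg_of_pos (mul_nonneg h0 (hx.pos n).le) (mul_pos (sub_pos.2 h1) (hx.pos _))
  refine alphaRadius_lt (x := caterpillarVector α l n r x) hconn h1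
    (pendantExtension_pos h1 hl fun i : Fin (n + 1) => hx.pos i) ?_
  rw [hx.alphaMatrix_mulVec_eq hl]
  exact sub_lt_self _ (Pi.single_pos.2 hdefect)

theorem sub_div_le_alphaRadius_caterpillar (hx : IsSpineWeight α l r x) (h0 : 0 ≤ α) (h1 : α < 1)
    (hl : α < l) (n : ℕ) :
    l - (α * x n + (1 - α) * x (n + 1)) * x n / ∑ i ∈ range (n + 1), x i ^ 2
      ≤ alphaRadius α (caterpillar n r) := by
  refine le_trans ?_ (sub_div_le_alphaRadius (fun h => (hx.pos 0).ne' (congrFun h (.inl 0)))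
    (hx.alphaMatrix_mulVec_eq hl n))
  have hspine : ∑ i ∈ range (n + 1), x i ^ 2
      ≤ caterpillarVector α l n r x ⬝ᵥ caterpillarVector α l n r x := by
    rw [dotProduct, Fintype.sum_sum_type, ← Fin.sum_univ_eq_sum_range fun i => x i ^ 2]
    simp only [sq]
    exact le_add_of_nonneg_right (sum_nonneg fun p _ => mul_self_nonneg _)
  have := hx.pos n
  have := hx.pos (n + 1)
  have := sub_pos.2 h1
  have : 0 < ∑ i ∈ range (n + 1), x i ^ 2 := sum_pos (fun i _ => pow_pos (hx.pos i) 2) (by simp)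
  refine sub_le_sub_left (div_le_div_of_nonneg_left (by positivity) this hspine) _

end IsSpineWeight

end Caterpillars

section Parametrisation

/-- The parametrisation `l = 2α + (1 - α)(s + s⁻¹)` of the half-line `l > 2` by `0 < s < 1`. -/
noncomputable def spectralParam (α s : ℝ) : ℝ := 2 * α + (1 - α) * (s + s⁻¹)

/-- The ratio `γ = α / (1 - α)`: up to the factor `1 - α`, the matrix `A_α` is `A + γ D`. -/
noncomputable def alphaRatio (α : ℝ) : ℝ := α / (1 - α)

/-- The number `δ_α / (1 - α)` as a function of `γ = α / (1 - α)` and `s`. -/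
noncomputable def leafWeight (γ s : ℝ) : ℝ := γ + (γ + s + s⁻¹)⁻¹

variable {α s : ℝ}

theorem mul_alphaRatio (hα : α ≠ 1) : (1 - α) * alphaRatio α = α :=
  mul_div_cancel₀ α (sub_ne_zero.2 hα.symm)

theorem alphaRatio_nonneg (h0 : 0 ≤ α) (h1 : α < 1) : 0 ≤ alphaRatio α :=
  div_nonneg h0 (sub_pos.2 h1).le

theorem leafWeight_pos {γ : ℝ} (hγ : 0 ≤ γ) (hs : 0 < s) : 0 < leafWeight γ s := by
  unfold leafWeight
  positivity

theorem deltaAlpha_spectralParam (hα : α ≠ 1) (s : ℝ) :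
    deltaAlpha α (spectralParam α s) = (1 - α) * leafWeight (alphaRatio α) s := by
  have hγ := mul_alphaRatio hα
  have hsub : spectralParam α s - α = (1 - α) * (alphaRatio α + s + s⁻¹) := by
    unfold spectralParam
    linear_combination -hγ
  rw [deltaAlpha, hsub, sq, mul_div_mul_left _ _ (sub_ne_zero.2 hα.symm), leafWeight, mul_add, hγ,
    div_eq_mul_inv]

theorem two_lt_spectralParam (hα : α < 1) (hs : s ∈ Set.Ioo 0 1) : 2 < spectralParam α s := by
  have hinv : s * s⁻¹ = 1 := mul_inv_cancel₀ hs.1.ne'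
  have hgt : 1 < s⁻¹ := (one_lt_inv₀ hs.1).2 hs.2
  have hsum : 2 < s + s⁻¹ := by nlinarith [mul_pos (sub_pos.2 hs.2) (sub_pos.2 hgt)]
  unfold spectralParam
  nlinarith

end Parametrisation

section Pivots

/-- Ratios `c n = x (n + 1) / x n` of consecutive spine weights of the greedy caterpillar: `r n`
pendant vertices are attached so as to bring `c n` into the window `[s, s + D)`. -/
structure IsPivotSequence (s D : ℝ) (r : ℕ → ℕ) (c : ℕ → ℝ) : Prop where
  mem_Ico : ∀ n, c n ∈ Set.Ico s (s + D)
  succ : ∀ n, c (n + 1) = s + s⁻¹ - r (n + 1) * D - (c n)⁻¹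

theorem exists_sub_nat_mul_mem_Ico {s D y : ℝ} (hD : 0 < D) (hy : s ≤ y) :
    ∃ k : ℕ, y - k * D ∈ Set.Ico s (s + D) := by
  refine ⟨⌊(y - s) / D⌋₊, ?_, ?_⟩
  · have := (le_div_iff₀ hD).1 (Nat.floor_le (div_nonneg (sub_nonneg.2 hy) hD.le))
    linarith
  · have := (div_lt_iff₀ hD).1 (Nat.lt_floor_add_one ((y - s) / D))
    linarith

theorem exists_isPivotSequence {s D y : ℝ} (hs : 0 < s) (hD : 0 < D) (hy : s ≤ y) :
    ∃ r c, IsPivotSequence s D r c ∧ c 0 = y - r 0 * D := by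
  choose! k hk using fun y (hy : s ≤ y) => exists_sub_nat_mul_mem_Ico hD hy
  let Y : ℕ → ℝ := Nat.rec y fun _ y => s + s⁻¹ - (y - k y * D)⁻¹
  have hY : ∀ n, s ≤ Y n := by
    intro n
    induction n with
    | zero => exact hy
    | succ n ih => linarith [inv_anti₀ hs (hk _ ih).1, show Y (n + 1) = _ from rfl]
  refine ⟨fun n => k (Y n), fun n => Y n - k (Y n) * D, ⟨fun n => hk _ (hY n), fun n => ?_⟩, rfl⟩
  exact sub_right_comm _ _ _

namespace IsPivotSequence

variable {s D : ℝ} {r : ℕ → ℕ} {c : ℕ → ℝ}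

theorem pos (hc : IsPivotSequence s D r c) (hs : 0 < s) (n : ℕ) : 0 < c n :=
  hs.trans_le (hc.mem_Ico n).1

/-- Induction outwards from the leafed position `n + k + 1`: the criticality condition compares the
two ratios next to it, and without leaves the recursion is reversed by `c ↦ c⁻¹`. -/
theorem mul_le_one (hc : IsPivotSequence s D r c) (hs : 0 < s) (hD : 0 < D)
    (hcrit : (s + s⁻¹ - D) * (s + D) ≤ 2) {k n : ℕ} (hzero : ∀ i ∈ Ioc n (n + k), r i = 0)
    (hr : r (n + k + 1) ≠ 0) : c n * c (n + 2 * k + 1) ≤ 1 := by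
  induction k generalizing n with
  | zero =>
    have hcn := hc.pos hs n
    have hleaf : D ≤ r (n + 1) * D :=
      le_mul_of_one_le_left hD.le (by exact_mod_cast Nat.one_le_iff_ne_zero.2 hr)
    have hle : c (n + 1) + (c n)⁻¹ ≤ s + s⁻¹ - D := by linarith [hc.succ n]
    calc c n * c (n + 1) = c n * (c (n + 1) + (c n)⁻¹) - 1 := by field_simp; ring
      _ ≤ (s + D) * (s + s⁻¹ - D) - 1 := by
        gcongr
        · exact (add_pos (hc.pos hs _) (inv_pos.2 hcn)).le
        · exact (hc.mem_Ico n).2.le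
      _ ≤ 1 := by linarith
  | succ k ih =>
    have hcn := hc.pos hs n
    have hinner : c (n + 1) * c (n + 2 * k + 2) ≤ 1 := by
      have := ih (n := n + 1) (fun i hi => hzero i (by grind)) (by convert hr using 2; ring)
      convert this using 3
      ring
    have hfirst : c (n + 1) = s + s⁻¹ - (c n)⁻¹ := by
      rw [hc.succ, hzero (n + 1) (by simp), Nat.cast_zero, zero_mul, sub_zero]
    have hlast : c (n + 2 * k + 3) ≤ s + s⁻¹ - (c (n + 2 * k + 2))⁻¹ := by
      rw [hc.succ]
      linarith [mul_nonneg (Nat.cast_nonneg' (α := ℝ) (r (n + 2 * k + 2 + 1))) hD.le]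
    have hinv : c (n + 1) ≤ (c (n + 2 * k + 2))⁻¹ :=
      (le_inv_mul_iff₀ (hc.pos hs _)).2 (by linarith) |>.trans_eq (mul_one _)
    calc c n * c (n + 2 * k + 3) ≤ c n * (c n)⁻¹ := by gcongr; linarith
      _ = 1 := mul_inv_cancel₀ hcn.ne'

theorem prod_range_add_le_one (hc : IsPivotSequence s D r c) (hs : 0 < s) (hD : 0 < D)
    (hcrit : (s + s⁻¹ - D) * (s + D) ≤ 2) {k n : ℕ} (hzero : ∀ i ∈ Ioc n (n + k), r i = 0)
    (hr : r (n + k + 1) ≠ 0) : ∏ i ∈ range (2 * k + 2), c (n + i) ≤ 1 := by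
  have hends := hc.mul_le_one hs hD hcrit hzero hr
  induction k generalizing n with
  | zero => simpa [prod_range_succ] using hends
  | succ k ih =>
    have hzero' : ∀ i ∈ Ioc (n + 1) (n + 1 + k), r i = 0 := fun i hi => hzero i (by grind)
    have hr' : r (n + 1 + k + 1) ≠ 0 := by convert hr using 2; ring
    have hinner := ih hzero' hr' (hc.mul_le_one hs hD hcrit hzero' hr')
    calc ∏ i ∈ range (2 * (k + 1) + 2), c (n + i)
        = (∏ i ∈ range (2 * k + 2), c (n + 1 + i)) * (c n * c (n + 2 * (k + 1) + 1)) := by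
          rw [show 2 * (k + 1) + 2 = 2 * k + 2 + 1 + 1 by ring, prod_range_succ, prod_range_succ',
            add_zero, mul_assoc]
          congr! 3
          ring
      _ ≤ 1 := mul_le_one₀ hinner (mul_pos (hc.pos hs _) (hc.pos hs _)).le hends

theorem exists_ne_zero (hc : IsPivotSequence s D r c) (hs : 0 < s) (hwindow : s + D < s⁻¹)
    {n : ℕ} (hn : s < c n) : ∃ k, r (n + k + 1) ≠ 0 := by
  by_contra! hzero
  have hsD : 0 < s + D := (hc.pos hs n).trans (hc.mem_Ico n).2
  have hq : 1 < (s * (s + D))⁻¹ := by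
    rw [one_lt_inv₀ (mul_pos hs hsD), ← mul_inv_cancel₀ hs.ne']
    gcongr
  have hgrow : ∀ k, (s * (s + D))⁻¹ ^ k * (c n - s) ≤ c (n + k) - s := by
    intro k
    induction k with
    | zero => simp
    | succ k ih =>
      have hck := hc.pos hs (n + k)
      have hle : (s * (s + D))⁻¹ ≤ (s * c (n + k))⁻¹ := by
        gcongr
        exact (hc.mem_Ico _).2.le
      calc (s * (s + D))⁻¹ ^ (k + 1) * (c n - s)
          = (s * (s + D))⁻¹ * ((s * (s + D))⁻¹ ^ k * (c n - s)) := by ring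
        _ ≤ (s * c (n + k))⁻¹ * (c (n + k) - s) := by
          gcongr
        _ = c (n + (k + 1)) - s := by
          rw [← add_assoc, hc.succ, hzero, Nat.cast_zero]
          field_simp
          ring
  obtain ⟨k, hk⟩ := pow_unbounded_of_one_lt (D / (c n - s)) hq
  have := (div_lt_iff₀ (sub_pos.2 hn)).1 hk
  linarith [hgrow k, (hc.mem_Ico (n + k)).2]

theorem exists_prod_range_le (hc : IsPivotSequence s D r c) (hs : s ∈ Set.Ioo 0 1) (hD : 0 < D)
    (hwindow : s + D < s⁻¹) (hcrit : (s + s⁻¹ - D) * (s + D) ≤ 2) (n : ℕ) :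
    ∃ m > n, ∏ i ∈ range m, c i ≤ ∏ i ∈ range n, c i := by
  have hprod : ∀ j, ∏ i ∈ range j, c (n + i) ≤ 1 → ∏ i ∈ range (n + j), c i ≤ ∏ i ∈ range n, c i :=
    fun j hj => by
      rw [prod_range_add]
      exact mul_le_of_le_one_right (prod_nonneg fun i _ => (hc.pos hs.1 i).le) hj
  rcases le_or_gt (c n) 1 with hle | hgt
  · exact ⟨n + 1, by omega, hprod 1 (by simpa using hle)⟩
  · have hex := hc.exists_ne_zero hs.1 hwindow (hs.2.trans hgt)
    refine ⟨n + (2 * Nat.find hex + 2), by omega, hprod _ (hc.prod_range_add_le_one hs.1 hD hcrit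
      (fun i hi => ?_) (Nat.find_spec hex))⟩
    have := Nat.find_min hex (m := i - n - 1) (by grind)
    grind

end IsPivotSequence

theorem exists_mul_le_sum_range {f : ℕ → ℝ} (hf : ∀ n, 0 ≤ f n) (hlater : ∀ n, ∃ m > n, f m ≤ f n)
    (k : ℕ) : ∃ n, k * f n ≤ ∑ i ∈ range (n + 1), f i := by
  induction k with
  | zero => exact ⟨0, by simpa using hf 0⟩
  | succ k ih =>
    obtain ⟨n, hn⟩ := ih
    obtain ⟨m, hm, hle⟩ := hlater n
    refine ⟨m, ?_⟩
    calc ((k + 1 : ℕ) : ℝ) * f m = k * f m + f m := by push_cast; ring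
      _ ≤ ∑ i ∈ range (n + 1), f i + f m := by gcongr; exact hn.trans' (by gcongr)
      _ ≤ ∑ i ∈ range m, f i + f m := by gcongr; exacts [fun i _ _ => hf i, hm]
      _ = ∑ i ∈ range (m + 1), f i := (sum_range_succ f m).symm

end Pivots

section CaterpillarLimits

variable {α s : ℝ}

theorem IsPivotSequence.isSpineWeight {r : ℕ → ℕ} {c : ℕ → ℝ} (hα : α ≠ 1) (hs : 0 < s)
    (hc : IsPivotSequence s (leafWeight (alphaRatio α) s) r c)
    (hzero : c 0 = alphaRatio α + s + s⁻¹ - r 0 * leafWeight (alphaRatio α) s) :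
    IsSpineWeight α (spectralParam α s) r fun n => ∏ i ∈ range n, c i where
  pos n := prod_pos fun i _ => hc.pos hs i
  zero := by
    rw [deltaAlpha_spectralParam hα, prod_range_one, prod_range_zero, hzero, spectralParam]
    linear_combination mul_alphaRatio hα
  succ n := by
    have hinv : c n * (c n)⁻¹ = 1 := mul_inv_cancel₀ (hc.pos hs n).ne'
    rw [deltaAlpha_spectralParam hα, prod_range_succ c (n + 1), prod_range_succ c n, hc.succ,
      spectralParam]
    linear_combination -(1 - α) * (∏ i ∈ range n, c i) * hinv

theorem exists_alphaRadius_caterpillar_mem_Ioo (h0 : 0 ≤ α) (h1 : α < 1) (hs : s ∈ Set.Ioo 0 1)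
    (hwindow : s + leafWeight (alphaRatio α) s < s⁻¹)
    (hcrit : (s + s⁻¹ - leafWeight (alphaRatio α) s) * (s + leafWeight (alphaRatio α) s) ≤ 2)
    {ε : ℝ} (hε : 0 < ε) :
    ∃ n r, alphaRadius α (caterpillar n r)
      ∈ Set.Ioo (spectralParam α s - ε) (spectralParam α s) := by
  have hl : α < spectralParam α s := by linarith [two_lt_spectralParam h1 hs]
  have hγ := alphaRatio_nonneg h0 h1
  have hD := leafWeight_pos hγ hs.1
  set D := leafWeight (alphaRatio α) s
  obtain ⟨r, c, hc, hzero⟩ := exists_isPivotSequence (y := alphaRatio α + s + s⁻¹) hs.1 hD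
    (by linarith [inv_pos.2 hs.1])
  have hx := hc.isSpineWeight h1.ne hs.1 hzero
  set x : ℕ → ℝ := fun n => ∏ i ∈ range n, c i
  obtain ⟨k, hk⟩ := exists_nat_gt ((α + (1 - α) * (s + D)) / ε)
  obtain ⟨n, hn⟩ := exists_mul_le_sum_range (f := fun n => x n ^ 2) (fun n => sq_nonneg _)
    (fun n => (hc.exists_prod_range_le hs hD hwindow hcrit n).imp fun m hm =>
      ⟨hm.1, pow_le_pow_left₀ (hx.pos m).le hm.2 2⟩) k
  refine ⟨n, r, ?_, hx.alphaRadius_caterpillar_lt h0 h1 hl n⟩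
  refine lt_of_lt_of_le (sub_lt_sub_left ?_ _) (hx.sub_div_le_alphaRadius_caterpillar h0 h1 hl n)
  have hxn : 0 < x n ^ 2 := pow_pos (hx.pos n) 2
  rw [div_lt_iff₀ (sum_pos (fun i _ => pow_pos (hx.pos i) 2) (by simp))]
  calc (α * x n + (1 - α) * x (n + 1)) * x n = (α + (1 - α) * c n) * x n ^ 2 := by
        rw [show x (n + 1) = x n * c n from prod_range_succ c n]
        ring
    _ ≤ (α + (1 - α) * (s + D)) * x n ^ 2 := by
        gcongr
        exact (hc.mem_Ico n).2.le
    _ < ε * (k * x n ^ 2) := by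
        rw [← mul_assoc, mul_comm ε]
        gcongr
        exact (div_lt_iff₀ hε).1 hk
    _ ≤ ε * ∑ i ∈ range (n + 1), x i ^ 2 := by gcongr

theorem spectralParam_mem_derivedSet_alphaRadii (h0 : 0 ≤ α) (h1 : α < 1) (hs : s ∈ Set.Ioo 0 1)
    (hwindow : s + leafWeight (alphaRatio α) s < s⁻¹)
    (hcrit : (s + s⁻¹ - leafWeight (alphaRatio α) s) * (s + leafWeight (alphaRatio α) s) ≤ 2) :
    spectralParam α s ∈ derivedSet (alphaRadii α) := by
  refine mem_derivedSet.2 (accPt_iff_nhds.2 fun U hU => ?_)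
  obtain ⟨ε, hε, hball⟩ := Metric.mem_nhds_iff.1 hU
  obtain ⟨n, r, hρ⟩ := exists_alphaRadius_caterpillar_mem_Ioo h0 h1 hs hwindow hcrit hε
  refine ⟨_, ⟨hball ?_, alphaRadius_mem_alphaRadii α (caterpillar n r)⟩, hρ.2.ne⟩
  rw [Real.ball_eq_Ioo]
  exact ⟨hρ.1, hρ.2.trans (lt_add_of_pos_right _ hε)⟩

end CaterpillarLimits

section Equations

variable {α γ s : ℝ}

theorem spectralParam_strictAntiOn (hα : α < 1) :
    StrictAntiOn (spectralParam α) (Set.Ioo 0 1) := by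
  intro s hs t ht hst
  have hmul : s * t < 1 := mul_lt_one_of_nonneg_of_lt_one_left hs.1.le hs.2 ht.2.le
  have hdiff : s + s⁻¹ - (t + t⁻¹) = (t - s) * (1 - s * t) / (s * t) := by
    field_simp [hs.1.ne', ht.1.ne']
    ring
  have hpos : 0 < s + s⁻¹ - (t + t⁻¹) := by
    rw [hdiff]
    exact div_pos (mul_pos (sub_pos.2 hst) (sub_pos.2 hmul)) (mul_pos hs.1 ht.1)
  have := mul_pos (sub_pos.2 hα) hpos
  unfold spectralParam
  linarith

theorem image_spectralParam (hα : α < 1) : spectralParam α '' Set.Ioo 0 1 = Set.Ioi 2 := by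
  refine (Set.image_subset_iff.2 fun s hs => two_lt_spectralParam hα hs).antisymm fun l hl => ?_
  have hβ := sub_pos.2 hα
  have hu : 2 < (l - 2 * α) / (1 - α) := by
    rw [lt_div_iff₀ hβ]
    linarith [Set.mem_Ioi.1 hl]
  obtain ⟨s, hs, hroot⟩ := intermediate_value_Ioo' zero_le_one
    (f := fun s => s ^ 2 - (l - 2 * α) / (1 - α) * s + 1) (by fun_prop)
    (show (0 : ℝ) ∈ _ from ⟨by linarith, by norm_num⟩)
  refine ⟨s, hs, ?_⟩
  have hsum : s + s⁻¹ = (l - 2 * α) / (1 - α) := by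
    field_simp [hs.1.ne'] at hroot ⊢
    linarith
  calc spectralParam α s = 2 * α + (1 - α) * ((l - 2 * α) / (1 - α)) := by rw [← hsum]; rfl
    _ = l := by rw [mul_div_cancel₀ _ hβ.ne']; ring

theorem setOf_two_lt_and_eq_image (hα : α < 1) (p : ℝ → Prop) :
    {l | 2 < l ∧ p l} = spectralParam α '' {s ∈ Set.Ioo 0 1 | p (spectralParam α s)} := by
  ext l
  constructor
  · rintro ⟨hl, hp⟩
    obtain ⟨s, hs, rfl⟩ := (image_spectralParam hα).ge hl
    exact ⟨s, ⟨hs, hp⟩, rfl⟩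
  · rintro ⟨s, ⟨hs, hp⟩, rfl⟩
    exact ⟨two_lt_spectralParam hα hs, hp⟩

theorem thetaAlpha'_spectralParam (hα : α < 1) (hs : s ∈ Set.Ioo 0 1) :
    thetaAlpha' α (spectralParam α s) = -((1 - α) * s) := by
  have hinv : s * s⁻¹ = 1 := mul_inv_cancel₀ hs.1.ne'
  have hsquare : (2 * α - spectralParam α s) ^ 2 - 4 * (1 - α) ^ 2
      = ((1 - α) * (s⁻¹ - s)) ^ 2 := by
    unfold spectralParam
    linear_combination 4 * (1 - α) ^ 2 * hinv
  have hnonneg : 0 ≤ (1 - α) * (s⁻¹ - s) :=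
    mul_nonneg (sub_pos.2 hα).le (sub_nonneg.2 (hs.2.trans ((one_lt_inv₀ hs.1).2 hs.2)).le)
  rw [thetaAlpha', hsquare, Real.sqrt_sq hnonneg, spectralParam]
  ring

theorem funF0_spectralParam (hα : α < 1) (hs : s ∈ Set.Ioo 0 1) :
    funF0 α (spectralParam α s) = (1 - α) * (leafWeight (alphaRatio α) s + s - s⁻¹) := by
  have hdelta := deltaAlpha_spectralParam hα.ne s
  have hparam : spectralParam α s = 2 * α + (1 - α) * (s + s⁻¹) := rfl
  have hneg : (1 - α) ^ 2 / (α - spectralParam α s) = -((1 - α) ^ 2 / (spectralParam α s - α)) := by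
    rw [← neg_sub (spectralParam α s), div_neg]
  rw [deltaAlpha] at hdelta
  rw [funF0, thetaAlpha'_spectralParam hα hs, hneg]
  linear_combination hdelta - hparam

theorem funF1_spectralParam (hα : α < 1) (hs : s ∈ Set.Ioo 0 1) :
    funF1 α (spectralParam α s) = (1 - α) ^ 2 *
      ((s + s⁻¹ - leafWeight (alphaRatio α) s) * (s + leafWeight (alphaRatio α) s) - 2) := by
  rw [funF1, thetaAlpha'_spectralParam hα hs, deltaAlpha_spectralParam hα.ne, spectralParam]
  ring

theorem mem_derivedSet_alphaRadii (h0 : 0 ≤ α) (h1 : α < 1) {l : ℝ} (hl : 2 < l)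
    (hF0 : funF0 α l < 0) (hF1 : funF1 α l ≤ 0) : l ∈ derivedSet (alphaRadii α) := by
  obtain ⟨s, hs, rfl⟩ := (image_spectralParam h1).ge hl
  have hβ := sub_pos.2 h1
  rw [funF0_spectralParam h1 hs] at hF0
  rw [funF1_spectralParam h1 hs] at hF1
  refine spectralParam_mem_derivedSet_alphaRadii h0 h1 hs ?_ ?_
  · linarith [(pos_iff_neg_of_mul_neg hF0).1 hβ]
  · exact sub_nonpos.1 (nonpos_of_mul_nonpos_right hF1 (pow_pos hβ 2))

/-- The numerator of `F₀` in terms of `γ` and `s`. -/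
def quarticF0 (γ s : ℝ) : ℝ := (s ^ 2 + γ * s) ^ 2 + s ^ 2 - 1

/-- A positive multiple of `s - leafWeight γ s`, normalised so as to be monotone in `s`. -/
noncomputable def leafGap (γ s : ℝ) : ℝ := s ^ 2 - γ ^ 2 - γ / s

theorem leafWeight_add_sub_inv (hγ : 0 ≤ γ) (hs : 0 < s) :
    leafWeight γ s + s - s⁻¹ = quarticF0 γ s / (s * (s ^ 2 + γ * s + 1)) := by
  have : γ + s + s⁻¹ = (s ^ 2 + γ * s + 1) / s := by field_simp; ring
  rw [leafWeight, this, quarticF0]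
  field_simp
  ring

theorem sub_leafWeight (hγ : 0 ≤ γ) (hs : 0 < s) :
    s - leafWeight γ s = s * leafGap γ s / (s ^ 2 + γ * s + 1) := by
  have : γ + s + s⁻¹ = (s ^ 2 + γ * s + 1) / s := by field_simp; ring
  rw [leafWeight, this, leafGap]
  field_simp
  ring

theorem funF0_spectralParam_eq_div (h0 : 0 ≤ α) (h1 : α < 1) (hs : s ∈ Set.Ioo 0 1) :
    funF0 α (spectralParam α s)
      = (1 - α) * quarticF0 (alphaRatio α) s / (s * (s ^ 2 + alphaRatio α * s + 1)) := by
  rw [funF0_spectralParam h1 hs, leafWeight_add_sub_inv (alphaRatio_nonneg h0 h1) hs.1,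
    mul_div_assoc]

theorem funF1_spectralParam_eq_div (h0 : 0 ≤ α) (h1 : α < 1) (hs : s ∈ Set.Ioo 0 1) :
    funF1 α (spectralParam α s)
      = (1 - α) ^ 2 * (leafGap (alphaRatio α) s * quarticF0 (alphaRatio α) s)
        / (s ^ 2 + alphaRatio α * s + 1) ^ 2 := by
  have hγ := alphaRatio_nonneg h0 h1
  have hs0 := hs.1.ne'
  have hfactor : ∀ D, (s + s⁻¹ - D) * (s + D) - 2 = (s - D) * (D + s - s⁻¹) := fun D => by
    field_simp
    ring
  rw [funF1_spectralParam h1 hs, hfactor, sub_leafWeight hγ hs.1, leafWeight_add_sub_inv hγ hs.1]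
  field_simp

theorem quarticF0_strictMonoOn (hγ : 0 ≤ γ) : StrictMonoOn (quarticF0 γ) (Set.Ici 0) := by
  intro s hs t _ hst
  have hs : 0 ≤ s := hs
  have hsquare : s ^ 2 < t ^ 2 := by gcongr
  have : (s ^ 2 + γ * s) ^ 2 ≤ (t ^ 2 + γ * t) ^ 2 := by gcongr
  unfold quarticF0
  linarith

theorem quarticF0_lt_of_lt {γ' : ℝ} (hγ : 0 ≤ γ) (hs : 0 < s) (hlt : γ < γ') :
    quarticF0 γ s < quarticF0 γ' s := by
  unfold quarticF0
  gcongr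

theorem leafGap_strictMonoOn (hγ : 0 ≤ γ) : StrictMonoOn (leafGap γ) (Set.Ioi 0) := by
  intro s hs t _ hst
  have hs : 0 < s := hs
  have hsquare : s ^ 2 < t ^ 2 := by gcongr
  have : γ / t ≤ γ / s := by gcongr
  unfold leafGap
  linarith

theorem leafGap_lt_of_lt {γ' : ℝ} (hγ : 0 ≤ γ) (hs : 0 < s) (hlt : γ < γ') :
    leafGap γ' s < leafGap γ s := by
  unfold leafGap
  gcongr

theorem exists_quarticF0_eq_zero (hγ : 0 ≤ γ) : ∃ s ∈ Set.Ioo 0 1, quarticF0 γ s = 0 := by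
  have hcont : ContinuousOn (quarticF0 γ) (Set.Icc 0 1) := by
    unfold quarticF0
    fun_prop
  refine intermediate_value_Ioo zero_le_one hcont ⟨by norm_num [quarticF0], ?_⟩
  norm_num [quarticF0]
  positivity

theorem quarticF0_eq_zero_iff (hγ : 0 ≤ γ) (hs : 0 < s) (hroot : quarticF0 γ s = 0) {t : ℝ}
    (ht : 0 < t) : quarticF0 γ t = 0 ↔ t = s := by
  rw [← hroot, (quarticF0_strictMonoOn hγ).injOn.eq_iff ht.le hs.le]

theorem leafGap_eq_zero_iff (hγ : 0 ≤ γ) (hs : 0 < s) (hroot : leafGap γ s = 0) {t : ℝ}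
    (ht : 0 < t) : leafGap γ t = 0 ↔ t = s := by
  rw [← hroot, (leafGap_strictMonoOn hγ).injOn.eq_iff ht hs]

theorem funF0_spectralParam_eq_zero_iff (h0 : 0 ≤ α) (h1 : α < 1) (hs : s ∈ Set.Ioo 0 1) :
    funF0 α (spectralParam α s) = 0 ↔ quarticF0 (alphaRatio α) s = 0 := by
  have hγ := alphaRatio_nonneg h0 h1
  have := hs.1
  rw [funF0_spectralParam_eq_div h0 h1 hs, div_eq_zero_iff, or_iff_left (by positivity),
    mul_eq_zero, or_iff_right (sub_pos.2 h1).ne']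

theorem funF1_spectralParam_eq_zero_iff (h0 : 0 ≤ α) (h1 : α < 1) (hs : s ∈ Set.Ioo 0 1) :
    funF1 α (spectralParam α s) = 0
      ↔ quarticF0 (alphaRatio α) s = 0 ∨ leafGap (alphaRatio α) s = 0 := by
  have hγ := alphaRatio_nonneg h0 h1
  have := hs.1
  rw [funF1_spectralParam_eq_div h0 h1 hs, div_eq_zero_iff, or_iff_left (by positivity),
    mul_eq_zero, or_iff_right (pow_pos (sub_pos.2 h1) 2).ne', mul_eq_zero, or_comm]

theorem isTau0_spectralParam (h0 : 0 ≤ α) (h1 : α < 1) (hs : s ∈ Set.Ioo 0 1)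
    (hroot : quarticF0 (alphaRatio α) s = 0) : IsTau0 α (spectralParam α s) := by
  have hzeros : {t ∈ Set.Ioo 0 1 | funF0 α (spectralParam α t) = 0} = {s} := by
    ext t
    refine ⟨fun ⟨ht, h⟩ => ?_, ?_⟩
    · exact (quarticF0_eq_zero_iff (alphaRatio_nonneg h0 h1) hs.1 hroot ht.1).1
        ((funF0_spectralParam_eq_zero_iff h0 h1 ht).1 h)
    · rintro rfl
      exact ⟨hs, (funF0_spectralParam_eq_zero_iff h0 h1 hs).2 hroot⟩
  rw [IsTau0, setOf_two_lt_and_eq_image h1, hzeros, Set.image_singleton]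

theorem setOf_funF1_eq_zero (h0 : 0 ≤ α) (h1 : α < 1) (hs : s ∈ Set.Ioo 0 1)
    (hroot : quarticF0 (alphaRatio α) s = 0) :
    {l | 2 < l ∧ funF1 α l = 0} = insert (spectralParam α s)
      (spectralParam α '' {t ∈ Set.Ioo 0 1 | leafGap (alphaRatio α) t = 0}) := by
  have hzeros : {t ∈ Set.Ioo 0 1 | funF1 α (spectralParam α t) = 0}
      = insert s {t ∈ Set.Ioo 0 1 | leafGap (alphaRatio α) t = 0} := by
    ext t
    refine ⟨fun ⟨ht, h⟩ => ?_, ?_⟩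
    · refine ((funF1_spectralParam_eq_zero_iff h0 h1 ht).1 h).imp (fun h => ?_) fun h => ⟨ht, h⟩
      exact (quarticF0_eq_zero_iff (alphaRatio_nonneg h0 h1) hs.1 hroot ht.1).1 h
    · rintro (rfl | ⟨ht, h⟩)
      · exact ⟨hs, (funF1_spectralParam_eq_zero_iff h0 h1 hs).2 (.inl hroot)⟩
      · exact ⟨ht, (funF1_spectralParam_eq_zero_iff h0 h1 ht).2 (.inr h)⟩
  rw [setOf_two_lt_and_eq_image h1, hzeros, Set.image_insert_eq]

theorem setOf_funF1_eq_zero_eq_pair (h0 : 0 ≤ α) (h1 : α < 1) (hs : s ∈ Set.Ioo 0 1)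
    (hroot : quarticF0 (alphaRatio α) s = 0) {s' : ℝ} (hs' : s' ∈ Set.Ioo 0 1)
    (hgap : leafGap (alphaRatio α) s' = 0) :
    {l | 2 < l ∧ funF1 α l = 0} = {spectralParam α s, spectralParam α s'} := by
  have hzeros : {t ∈ Set.Ioo 0 1 | leafGap (alphaRatio α) t = 0} = {s'} := by
    ext t
    refine ⟨fun ⟨ht, h⟩ => ?_, ?_⟩
    · exact (leafGap_eq_zero_iff (alphaRatio_nonneg h0 h1) hs'.1 hgap ht.1).1 h
    · rintro rfl
      exact ⟨hs', hgap⟩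
  rw [setOf_funF1_eq_zero h0 h1 hs hroot, hzeros, Set.image_singleton]

theorem funF0_spectralParam_neg (h0 : 0 ≤ α) (h1 : α < 1) (hs : s ∈ Set.Ioo 0 1)
    (hneg : quarticF0 (alphaRatio α) s < 0) : funF0 α (spectralParam α s) < 0 := by
  have hγ := alphaRatio_nonneg h0 h1
  have := hs.1
  rw [funF0_spectralParam_eq_div h0 h1 hs]
  exact div_neg_of_neg_of_pos (mul_neg_of_pos_of_neg (sub_pos.2 h1) hneg) (by positivity)

theorem funF1_spectralParam_neg (h0 : 0 ≤ α) (h1 : α < 1) (hs : s ∈ Set.Ioo 0 1)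
    (hneg : quarticF0 (alphaRatio α) s < 0) (hgap : 0 < leafGap (alphaRatio α) s) :
    funF1 α (spectralParam α s) < 0 := by
  have hγ := alphaRatio_nonneg h0 h1
  have := hs.1
  rw [funF1_spectralParam_eq_div h0 h1 hs]
  exact div_neg_of_neg_of_pos
    (mul_neg_of_pos_of_neg (pow_pos (sub_pos.2 h1) 2) (mul_neg_of_pos_of_neg hgap hneg))
    (by positivity)

end Equations

section Solutions

variable {α γ : ℝ}

theorem funF0_neg_and_funF1_neg (h0 : 0 ≤ α) (h1 : α < 1) {s₀ s₁ : ℝ} (hs₀ : s₀ ∈ Set.Ioo 0 1)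
    (hs₁ : s₁ ∈ Set.Ioo 0 1) (hroot : quarticF0 (alphaRatio α) s₀ = 0)
    (hgap : leafGap (alphaRatio α) s₁ = 0) {l : ℝ}
    (hl : l ∈ Set.Ioo (spectralParam α s₀) (spectralParam α s₁)) :
    funF0 α l < 0 ∧ funF1 α l < 0 := by
  obtain ⟨t, ht, rfl⟩ := (image_spectralParam h1).ge ((two_lt_spectralParam h1 hs₀).trans hl.1)
  have hγ := alphaRatio_nonneg h0 h1
  have hlt₀ := ((spectralParam_strictAntiOn h1).lt_iff_gt hs₀ ht).1 hl.1
  have hlt₁ := ((spectralParam_strictAntiOn h1).lt_iff_gt ht hs₁).1 hl.2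
  have hneg := hroot ▸ quarticF0_strictMonoOn hγ ht.1.le hs₀.1.le hlt₀
  have hpos := hgap ▸ leafGap_strictMonoOn hγ hs₁.1 ht.1 hlt₁
  exact ⟨funF0_spectralParam_neg h0 h1 ht hneg, funF1_spectralParam_neg h0 h1 ht hneg hpos⟩

theorem inv_sqrt_two_sq : (√2)⁻¹ ^ 2 = 1 / 2 := by
  rw [inv_pow, Real.sq_sqrt zero_le_two, one_div]

theorem inv_sqrt_two_mem_Ioo : (√2)⁻¹ ∈ Set.Ioo (0 : ℝ) 1 :=
  ⟨by positivity, inv_lt_one_of_one_lt₀ Real.one_lt_sqrt_two⟩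

theorem quarticF0_one_sub_inv_sqrt_two : quarticF0 (1 - (√2)⁻¹) (√2)⁻¹ = 0 := by
  have h := inv_sqrt_two_sq
  rw [quarticF0]
  linear_combination 2 * h

theorem leafGap_one_sub_inv_sqrt_two : leafGap (1 - (√2)⁻¹) (√2)⁻¹ = 0 := by
  have h := inv_sqrt_two_sq
  have : leafGap (1 - (√2)⁻¹) (√2)⁻¹ = (2 * (√2)⁻¹ ^ 2 - 1) / (√2)⁻¹ := by
    rw [leafGap]
    field_simp
    ring
  rw [this, h]
  norm_num

theorem exists_leafGap_eq_zero_lt_quarticF0_eq_zero (h0 : 0 < γ) (h1 : γ < 1 - (√2)⁻¹) :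
    ∃ s₁ ∈ Set.Ioo 0 1, ∃ s₀ ∈ Set.Ioo 0 1, s₁ < s₀ ∧ leafGap γ s₁ = 0 ∧ quarticF0 γ s₀ = 0 := by
  obtain ⟨hpos, hlt⟩ := inv_sqrt_two_mem_Ioo
  have hγ : γ ≤ (√2)⁻¹ := by nlinarith [inv_sqrt_two_sq]
  have hgap : 0 < leafGap γ (√2)⁻¹ :=
    leafGap_one_sub_inv_sqrt_two.symm.trans_lt (leafGap_lt_of_lt h0.le hpos h1)
  have hquartic : quarticF0 γ (√2)⁻¹ < 0 :=
    (quarticF0_lt_of_lt h0.le hpos h1).trans_eq quarticF0_one_sub_inv_sqrt_two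
  have hcont : ContinuousOn (leafGap γ) (Set.Icc γ (√2)⁻¹) := by
    unfold leafGap
    exact (by fun_prop : ContinuousOn _ _).sub
      (continuousOn_const.div continuousOn_id fun s hs => (h0.trans_le hs.1).ne')
  obtain ⟨s₁, hs₁, hroot₁⟩ := intermediate_value_Ioo hγ hcont
    (show (0 : ℝ) ∈ _ from ⟨by simp [leafGap, h0.ne'], hgap⟩)
  obtain ⟨s₀, hs₀, hroot₀⟩ := exists_quarticF0_eq_zero h0.le
  have hlt₀ : (√2)⁻¹ < s₀ :=
    ((quarticF0_strictMonoOn h0.le).lt_iff_lt hpos.le hs₀.1.le).1 (hquartic.trans_eq hroot₀.symm)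
  exact ⟨s₁, ⟨h0.trans hs₁.1, hs₁.2.trans hlt⟩, s₀, hs₀, hs₁.2.trans hlt₀, hroot₁, hroot₀⟩

theorem alphaStar_pos : 0 < alphaStar := by
  have := Real.sqrt_two_lt_three_halves
  unfold alphaStar
  linarith

theorem alphaStar_lt_one : alphaStar < 1 := by
  have := Real.sqrt_nonneg 2
  unfold alphaStar
  linarith

theorem alphaRatio_alphaStar : alphaRatio alphaStar = 1 - (√2)⁻¹ := by
  have hsq : √2 ^ 2 = 2 := Real.sq_sqrt zero_le_two
  have hne : 1 - alphaStar ≠ 0 := (sub_pos.2 alphaStar_lt_one).ne'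
  rw [alphaRatio, div_eq_iff hne, alphaStar]
  field_simp
  linear_combination -2 * hsq

theorem alphaRatio_strictMonoOn : StrictMonoOn alphaRatio (Set.Iio 1) := by
  intro a ha b hb hab
  have ha : 0 < 1 - a := sub_pos.2 ha
  have hb : 0 < 1 - b := sub_pos.2 hb
  rw [alphaRatio, alphaRatio, div_lt_div_iff₀ ha hb]
  linarith

theorem exists_isTau1Pair (h0 : 0 < α) (h : α < alphaStar) :
    ∃ t t', IsTau1Pair α t t' ∧ (∀ l ∈ Set.Ioo t t', funF1 α l < 0) ∧
      ∀ l ∈ Set.Ico t t', IsAlphaLimitPoint α l := by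
  have h1 := h.trans alphaStar_lt_one
  have hγ0 : 0 < alphaRatio α := div_pos h0 (sub_pos.2 h1)
  have hγ1 := (alphaRatio_strictMonoOn h1 alphaStar_lt_one h).trans_eq alphaRatio_alphaStar
  obtain ⟨s₁, hs₁, s₀, hs₀, hlt, hgap, hroot⟩ :=
    exists_leafGap_eq_zero_lt_quarticF0_eq_zero hγ0 hγ1
  have htt := spectralParam_strictAntiOn h1 hs₁ hs₀ hlt
  have hneg {l} := funF0_neg_and_funF1_neg h0.le h1 hs₀ hs₁ hroot hgap (l := l)
  have hIoo : Set.Ioo (spectralParam α s₀) (spectralParam α s₁) ⊆ derivedSet (alphaRadii α) :=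
    fun l hl => mem_derivedSet_alphaRadii h0.le h1 ((two_lt_spectralParam h1 hs₀).trans hl.1)
      (hneg hl).1 (hneg hl).2.le
  have hIcc := (isClosed_derivedSet _).closure_subset_iff.2 hIoo
  rw [closure_Ioo htt.ne] at hIcc
  exact ⟨_, _, ⟨isTau0_spectralParam h0.le h1 hs₀ hroot, htt,
    setOf_funF1_eq_zero_eq_pair h0.le h1 hs₀ hroot hs₁ hgap⟩, fun l hl => (hneg hl).2,
    fun l hl => isAlphaLimitPoint_of_mem_derivedSet (hIcc (Set.Ico_subset_Icc_self hl))⟩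

theorem exists_isTau0_alphaStar :
    ∃ t, IsTau0 alphaStar t ∧ {l | 2 < l ∧ funF1 alphaStar l = 0} = {t} := by
  have h0 := alphaStar_pos.le
  have hs := inv_sqrt_two_mem_Ioo
  have hroot : quarticF0 (alphaRatio alphaStar) (√2)⁻¹ = 0 := by
    rw [alphaRatio_alphaStar, quarticF0_one_sub_inv_sqrt_two]
  have hgap : leafGap (alphaRatio alphaStar) (√2)⁻¹ = 0 := by
    rw [alphaRatio_alphaStar, leafGap_one_sub_inv_sqrt_two]
  refine ⟨_, isTau0_spectralParam h0 alphaStar_lt_one hs hroot, ?_⟩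
  rw [setOf_funF1_eq_zero_eq_pair h0 alphaStar_lt_one hs hroot hs hgap, Set.pair_eq_singleton]

theorem alphaRatio_zero : alphaRatio 0 = 0 := zero_div _

theorem leafGap_alphaRatio_zero_pos {s : ℝ} (hs : 0 < s) : 0 < leafGap (alphaRatio 0) s := by
  simpa [alphaRatio_zero, leafGap] using pow_pos hs 2

theorem spectralParam_zero_eq_sqrt {s : ℝ} (hs : 0 < s) (hroot : quarticF0 (alphaRatio 0) s = 0) :
    spectralParam 0 s = √(2 + √5) := by
  have hquartic : s ^ 4 + s ^ 2 = 1 := by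
    rw [alphaRatio_zero, quarticF0] at hroot
    linear_combination hroot
  have hsqrt : √5 = 2 * s ^ 2 + 1 := by
    rw [Real.sqrt_eq_iff_mul_self_eq (by norm_num) (by positivity)]
    linear_combination -4 * hquartic
  have hinv : s⁻¹ ^ 2 = s ^ 2 + 1 := by
    field_simp
    linear_combination -hquartic
  have hparam : spectralParam 0 s = s + s⁻¹ := by simp [spectralParam]
  rw [hsqrt, hparam, eq_comm, Real.sqrt_eq_iff_mul_self_eq (by positivity) (by positivity)]
  linear_combination -hinv - 2 * mul_inv_cancel₀ hs.ne'

theorem funF0_zero_neg_and_funF1_zero_neg {s : ℝ} (hs : s ∈ Set.Ioo 0 1)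
    (hroot : quarticF0 (alphaRatio 0) s = 0) {l : ℝ} (hl : spectralParam 0 s < l) :
    funF0 0 l < 0 ∧ funF1 0 l < 0 := by
  obtain ⟨t, ht, rfl⟩ :=
    (image_spectralParam one_pos).ge ((two_lt_spectralParam one_pos hs).trans hl)
  have hlt := ((spectralParam_strictAntiOn one_pos).lt_iff_gt hs ht).1 hl
  have hneg := (quarticF0_strictMonoOn (alphaRatio_nonneg le_rfl one_pos) ht.1.le hs.1.le
    hlt).trans_eq hroot
  exact ⟨funF0_spectralParam_neg le_rfl one_pos ht hneg,
    funF1_spectralParam_neg le_rfl one_pos ht hneg (leafGap_alphaRatio_zero_pos ht.1)⟩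

theorem isTau0_zero_and_isAlphaLimitPoint_zero :
    IsTau0 0 √(2 + √5) ∧ {l | 2 < l ∧ funF1 0 l = 0} = {√(2 + √5)} ∧
      (∀ l ∈ Set.Ioi √(2 + √5), funF1 0 l < 0) ∧
      ∀ l ∈ Set.Ici √(2 + √5), IsAlphaLimitPoint 0 l := by
  obtain ⟨s, hs, hroot⟩ := exists_quarticF0_eq_zero (alphaRatio_nonneg le_rfl one_pos)
  rw [← spectralParam_zero_eq_sqrt hs.1 hroot]
  have hzeros : {t ∈ Set.Ioo (0 : ℝ) 1 | leafGap (alphaRatio 0) t = 0} = ∅ :=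
    Set.sep_eq_empty_iff_mem_false.2 fun t ht => (leafGap_alphaRatio_zero_pos ht.1).ne'
  have hneg {l} := funF0_zero_neg_and_funF1_zero_neg hs hroot (l := l)
  have hIoi : Set.Ioi (spectralParam 0 s) ⊆ derivedSet (alphaRadii 0) := fun l hl =>
    mem_derivedSet_alphaRadii le_rfl one_pos ((two_lt_spectralParam one_pos hs).trans hl)
      (hneg hl).1 (hneg hl).2.le
  have hIci := (isClosed_derivedSet _).closure_subset_iff.2 hIoi
  rw [closure_Ioi] at hIci
  refine ⟨isTau0_spectralParam le_rfl one_pos hs hroot, ?_, fun l hl => (hneg hl).2,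
    fun l hl => isAlphaLimitPoint_of_mem_derivedSet (hIci hl)⟩
  rw [setOf_funF1_eq_zero le_rfl one_pos hs hroot, hzeros, Set.image_empty, insert_empty_eq]

end Solutions

theorem theorem5p1 :
    -- the case `0 < α < α*`
    (∀ α : ℝ, 0 < α → α < alphaStar →
      ∃ t t' : ℝ, IsTau1Pair α t t' ∧
        (∀ l ∈ Set.Ioo t t', funF1 α l < 0) ∧
        (∀ l ∈ Set.Ico t t', IsAlphaLimitPoint α l)) ∧
    -- the case `α = 0`, where `τ₁(0) = √(2 + √5)` and `τ₁'(0) = ∞`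
    (IsTau0 0 √(2 + √5) ∧
      {l : ℝ | 2 < l ∧ funF1 0 l = 0} = {√(2 + √5)} ∧
      (∀ l ∈ Set.Ioi √(2 + √5), funF1 0 l < 0) ∧
      (∀ l ∈ Set.Ici √(2 + √5), IsAlphaLimitPoint 0 l)) ∧
    -- at `α*` the two solutions coincide
    (∃ t : ℝ, IsTau0 alphaStar t ∧ {l : ℝ | 2 < l ∧ funF1 alphaStar l = 0} = {t}) ∧
    -- `α*` is the largest number below which the interval `(τ₁(α), τ₁'(α))` exists and `F₁ < 0` on it
    IsGreatest
      {β : ℝ | 0 < β ∧ β ≤ 1 ∧ ∀ α : ℝ, 0 < α → α < β →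
        ∃ t t' : ℝ, IsTau1Pair α t t' ∧ ∀ l ∈ Set.Ioo t t', funF1 α l < 0}
      alphaStar := by
  refine ⟨fun α => exists_isTau1Pair, isTau0_zero_and_isAlphaLimitPoint_zero,
    exists_isTau0_alphaStar, ⟨alphaStar_pos, alphaStar_lt_one.le, fun α h0 h => ?_⟩, ?_⟩
  · obtain ⟨t, t', hpair, hneg, -⟩ := exists_isTau1Pair h0 h
    exact ⟨t, t', hpair, hneg⟩
  · rintro β ⟨-, -, hβ⟩
    by_contra! hlt
    obtain ⟨t, t', ⟨-, htt', hpair⟩, -⟩ := hβ alphaStar alphaStar_pos hlt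
    obtain ⟨s, -, hsingle⟩ := exists_isTau0_alphaStar
    have heq : ({t, t'} : Set ℝ) = {s} := hpair.symm.trans hsingle
    have hsub := Set.subsingleton_singleton.anti heq.le
    exact htt'.ne (hsub (.inl rfl) (.inr rfl))
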